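/- Conventions. For $K\ge 1$, $C\ge 0$, a map $f:X\to Y$ between metric spaces is a \emph{$(K,C)$-quasi-isometry} if $\frac1K(d_X(x_1,x_2)-C)\le d_Y(f(x_1),f(x_2))\le K\,d_X(x_1,x_2)+C$ for all $x_1,x_2\in X$ and some $R$-neighbourhood of $f(X)$ is all of $Y$; it is a \emph{quasi-isometry} if this holds for some $K,C$. A \emph{Kleiner--Leeb space} is a proper geodesic metric space $X$ on which the isometry group $\mathrm{Is}(X)$ acts cocompactly and such that for all $K\ge1$, $C>0$ there is $D>0$ such that for every $(K,C)$-quasi-isometry $f:X\to X$ there is a unique isometry $\widehat f\in\mathrm{Is}(X)$ with $d(f(x),\widehat f(x))<D$ for all $x\in X$. An \emph{approximate group} $(\Lambda,\Lambda^\infty)$ is a group $\Lambda^\infty$ with a generating subset $\Lambda$ such that $\Lambda=\Lambda^{-1}$, $e\in\Lambda$ and $\Lambda^2\subset F\Lambda$ for some finite $F\subset\Lambda^\infty$; it is \emph{finitely generated} if $\Lambda^\infty$ is, and $\Lambda$ then carries the restriction of the word metrics of $\Lambda^\infty$ with respect to finite generating sets. A compactly generated locally compact second countable (lcsc) group carries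 the word metrics with respect to compact generating sets. A homomorphism $\rho:\Lambda^\infty\to G$ has \emph{small kernel} if $\rho|_\Lambda:\Lambda\to\rho(\Lambda)$ is a quasi-isometry for the restrictions of the word metrics of $\Lambda^\infty$ and of the group $\langle\rho(\Lambda)\rangle$ with respect to finite generating sets. A \emph{uniform approximate lattice} in an lcsc group $G$ is a subset $A$ with $A=A^{-1}$, $e\in A$, $A^2\subset FA$ for some finite $F\subset G$, which is a Delone set, i.e. uniformly discrete and relatively dense with respect to some (equivalently, any) proper left-invariant metric inducing the topology of $G$. Theorem. Let $X$ be a Kleiner--Leeb space and let $G=\mathrm{Is}(X)$ with the compact-open topology. Then $G$ is a compactly generated lcsc group, and $G$ is QI-rigid with respect to approximate groups: for every finitely generated approximate group $(\Lambda,\Lambda^\infty)$ such that $\Lambda$ is quasi-isometric to $G$ there exists a homomorphism $\rho:\Lambda^\infty\to G$ with small kernel such that $\rho(\Lambda)$ is a uniform approximate lattice in $G$. -/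

import Mathlib

open scoped Pointwise

universe u v

namespace ApproxGroup

section QuasiIsometries

variable {X Y : Type*}

/-- `f` is a `(K, C)`-quasi-isometry from `(X, dX)` to `(Y, dY)`: a `(K, C)`-quasi-isometric
embedding some `R`-neighbourhood of whose image is everything. -/
structure IsQuasiIsometryWith (dX : X → X → ℝ) (dY : Y → Y → ℝ) (K C : ℝ) (f : X → Y) :
    Prop where
  lower : ∀ x₁ x₂, 1 / K * (dX x₁ x₂ - C) ≤ dY (f x₁) (f x₂)
  upper : ∀ x₁ x₂, dY (f x₁) (f x₂) ≤ K * dX x₁ x₂ + C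
  coarselyOnto : ∃ R : ℝ, 0 < R ∧ ∀ y, ∃ x, dY (f x) y < R

/-- `f` is a quasi-isometry from `(X, dX)` to `(Y, dY)`. -/
def IsQuasiIsometry (dX : X → X → ℝ) (dY : Y → Y → ℝ) (f : X → Y) : Prop :=
  ∃ K C : ℝ, 1 ≤ K ∧ 0 ≤ C ∧ IsQuasiIsometryWith dX dY K C f

end QuasiIsometries

section WordMetrics

variable {H : Type*} [Group H]

/-- The word length of `g` with respect to `S`: the least `n` such that `g` is a product of `n`
elements of `S ∪ S⁻¹`. It is used only for `g` in the subgroup generated by `S`. -/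
noncomputable def wordLength (S : Set H) (g : H) : ℕ :=
  sInf {n : ℕ | g ∈ (S ∪ S⁻¹) ^ n}

/-- The left-invariant word metric with respect to `S`. -/
noncomputable def wordDist (S : Set H) (g h : H) : ℝ :=
  (wordLength S (g⁻¹ * h) : ℝ)

end WordMetrics

section ApproximateGroups

variable {Γ : Type*} [Group Γ]

/-- `(Λ, Γ)` is an approximate group: `Λ` is symmetric, contains the identity, satisfies
`Λ² ⊆ F Λ` for some finite set `F`, and generates `Γ` (so that `Γ` is `Λ^∞`). -/
structure IsApproximateGroup (Λ : Set Γ) : Prop where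
  exists_isApproximateSubgroup : ∃ k : ℝ, IsApproximateSubgroup k Λ
  closure_eq_top : Subgroup.closure Λ = ⊤

/-- The approximate group `(Λ, Γ)` is quasi-isometric to the compactly generated group `G`, where
`Λ` carries the restriction of a word metric of `Γ` with respect to a finite generating set, and
`G` a word metric with respect to a compact generating set. -/
def QuasiIsometricToGroup (Λ : Set Γ) (G : Type*) [Group G] [TopologicalSpace G] : Prop :=
  ∃ S : Set Γ, S.Finite ∧ Subgroup.closure S = ⊤ ∧
    ∃ Q : Set G, IsCompact Q ∧ Subgroup.closure Q = ⊤ ∧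
      ∃ f : Λ → G, IsQuasiIsometry (fun a b : Λ => wordDist S (a : Γ) (b : Γ)) (wordDist Q) f

/-- The homomorphism `ρ` has small kernel on the approximate group `(Λ, Γ)`: the surjection
`Λ → ρ(Λ)` is a quasi-isometry, where `Λ` carries the restriction of any word metric of `Γ` with
respect to a finite generating set, and `ρ(Λ)` the restriction of any word metric of
`ρ(Λ)^∞ = ⟨ρ(Λ)⟩` with respect to a finite generating set. -/
def HasSmallKernel {G : Type*} [Group G] (Λ : Set Γ) (ρ : Γ →* G) : Prop :=
  ∀ S : Set Γ, S.Finite → Subgroup.closure S = ⊤ →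
    ∀ T : Set G, T.Finite → Subgroup.closure T = Subgroup.closure (ρ '' Λ) →
      IsQuasiIsometry (fun a b : Λ => wordDist S (a : Γ) (b : Γ))
        (fun a b : (ρ '' Λ : Set G) => wordDist T (a : G) (b : G))
        (Set.imageFactorization ρ Λ)

end ApproximateGroups

section TopologicalGroups

variable {G : Type*} [Group G] [TopologicalSpace G]

/-- `m` is a proper left-invariant metric on `G` which induces the given topology. -/
structure IsAdaptedMetric (m : MetricSpace G) : Prop where
  induces_topology : m.toUniformSpace.toTopologicalSpace = ‹TopologicalSpace G›
  proper : ProperSpace G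
  left_invariant : ∀ g x y : G, dist (g * x) (g * y) = dist x y

/-- `A` is a Delone set in `G`: it is uniformly discrete and relatively dense with respect to some
proper left-invariant metric inducing the topology. -/
def IsDelone (A : Set G) : Prop :=
  ∃ m : MetricSpace G, IsAdaptedMetric m ∧ ∃ D : Delone.DeloneSet G, D.carrier = A

/-- `A` is a uniform approximate lattice in `G`: an approximate subgroup which is Delone. -/
structure IsUniformApproximateLattice (A : Set G) : Prop where
  exists_isApproximateSubgroup : ∃ k : ℝ, IsApproximateSubgroup k A
  isDelone : IsDelone A

/-- `ρ` is a geometric representation of the approximate group `(Λ, Γ)` into `G`. -/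
structure IsGeometricRepresentation {Γ : Type*} [Group Γ] (Λ : Set Γ) (ρ : Γ →* G) : Prop where
  hasSmallKernel : HasSmallKernel Λ ρ
  isUniformApproximateLattice : IsUniformApproximateLattice (ρ '' Λ)

/-- `G` is a compactly generated lcsc group. -/
structure IsCompactlyGeneratedLCSCGroup (G : Type*) [Group G] [TopologicalSpace G] : Prop where
  isTopologicalGroup : IsTopologicalGroup G
  t2Space : T2Space G
  locallyCompactSpace : LocallyCompactSpace G
  secondCountableTopology : SecondCountableTopology G
  compactlyGenerated : ∃ Q : Set G, IsCompact Q ∧ Subgroup.closure Q = ⊤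

/-- `G` is QI-rigid with respect to approximate groups: every finitely generated approximate group
quasi-isometric to `G` admits a geometric representation into `G`. -/
def IsQIRigid (G : Type u) [Group G] [TopologicalSpace G] : Prop :=
  ∀ (Γ : Type v) [Group Γ] (Λ : Set Γ), IsApproximateGroup Λ → Group.FG Γ →
    QuasiIsometricToGroup Λ G → ∃ ρ : Γ →* G, IsGeometricRepresentation Λ ρ

end TopologicalGroups

section KleinerLeeb

/-- The compact-open topology on the isometry group `Is(X) = X ≃ᵢ X`. -/
instance isometryGroupTopology {X : Type*} [MetricSpace X] : TopologicalSpace (X ≃ᵢ X) :=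
  TopologicalSpace.induced (fun g => (⟨g, g.continuous⟩ : C(X, X))) inferInstance

/-- `X` is a geodesic metric space: any two points are joined by an isometrically embedded
interval. -/
def IsGeodesicSpace (X : Type*) [MetricSpace X] : Prop :=
  ∀ x y : X, ∃ c : ℝ → X, c 0 = x ∧ c (dist x y) = y ∧
    ∀ s ∈ Set.Icc 0 (dist x y), ∀ t ∈ Set.Icc 0 (dist x y), dist (c s) (c t) = |s - t|

/-- `X` is a Kleiner–Leeb space. -/
structure IsKleinerLeebSpace (X : Type*) [MetricSpace X] : Prop where
  proper : ProperSpace X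
  geodesic : IsGeodesicSpace X
  cocompact : ∃ Q : Set X, IsCompact Q ∧ ∀ x : X, ∃ g : X ≃ᵢ X, ∃ y ∈ Q, g y = x
  rigid : ∀ K C : ℝ, 1 ≤ K → 0 < C → ∃ D : ℝ, 0 < D ∧
    ∀ f : X → X, IsQuasiIsometryWith dist dist K C f →
      ∃! g : X ≃ᵢ X, ∀ x : X, dist (f x) (g x) < D

end KleinerLeeb

end ApproxGroup

/-! Left translations of `Λ` are transported to `X` and straightened to isometries. Since `Λ² ⊆ FΛ`,
every element of `Λ` translates `Λ` into a uniform neighbourhood of itself; hence every `g` in the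
generated group `Γ` translates `Λ` into some neighbourhood, whose radius depends on `g`. By a
Milnor–Schwarz argument (`exists_wordDist_dist_act_le`) `G` is quasi-isometric to `X`, so `Λ` is
too. Conjugating translation by `g` with this quasi-isometry `φ` gives a self-quasi-isometry of `X`,
and rigidity replaces it by an isometry `ρ g` at bounded distance (`exists_tracks`). Only the
identity is at bounded distance from the identity (`IsKleinerLeebSpace.eq_one_of_dist_le`), so `ρ g`
does not depend on the error bound and `ρ` is a homomorphism (`exists_hom_dist_le`).

For `a ∈ Λ` the error is uniform, so `ρ a` moves the base point to within bounded distance of `φ a`: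
the orbit map of `Λ` is again a quasi-isometry. Its lower bound gives the small kernel and, since
word balls are finite, uniform discreteness of `ρ(Λ)`. Its coarse density gives relative density,
because isometries of bounded displacement form a compact set. -/

namespace ApproxGroup

/-! ### Word lengths and word metrics. -/

section WordLength

variable {H : Type*} [Group H] {S : Set H} {g h : H}

theorem wordLength_le_of_mem_pow {n : ℕ} (hg : g ∈ (S ∪ S⁻¹) ^ n) : wordLength S g ≤ n :=
  Nat.sInf_le hg

theorem exists_mem_pow_of_mem_closure (hg : g ∈ Subgroup.closure S) :
    ∃ n : ℕ, g ∈ (S ∪ S⁻¹) ^ n := by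
  induction hg using Subgroup.closure_induction with
  | mem x hx => exact ⟨1, by simpa using Or.inl hx⟩
  | one => exact ⟨0, by simp⟩
  | mul x y _ _ hx hy =>
    obtain ⟨m, hm⟩ := hx
    obtain ⟨n, hn⟩ := hy
    exact ⟨m + n, by rw [pow_add]; exact Set.mul_mem_mul hm hn⟩
  | inv x _ hx =>
    obtain ⟨m, hm⟩ := hx
    refine ⟨m, ?_⟩
    have : ((S ∪ S⁻¹) ^ m)⁻¹ = (S ∪ S⁻¹) ^ m := by
      rw [← inv_pow, Set.union_inv, inv_inv, Set.union_comm]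
    rwa [← this, Set.inv_mem_inv]

theorem mem_pow_wordLength (hg : g ∈ Subgroup.closure S) :
    g ∈ (S ∪ S⁻¹) ^ wordLength S g :=
  Nat.sInf_mem (exists_mem_pow_of_mem_closure hg)

theorem wordLength_one : wordLength S (1 : H) = 0 :=
  Nat.le_zero.1 (wordLength_le_of_mem_pow (by simp))

theorem wordLength_mul_le (hg : g ∈ Subgroup.closure S) (hh : h ∈ Subgroup.closure S) :
    wordLength S (g * h) ≤ wordLength S g + wordLength S h := by
  apply wordLength_le_of_mem_pow
  rw [pow_add]
  exact Set.mul_mem_mul (mem_pow_wordLength hg) (mem_pow_wordLength hh)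

theorem wordLength_inv (S : Set H) (g : H) : wordLength S g⁻¹ = wordLength S g := by
  have (m : ℕ) : ((S ∪ S⁻¹) ^ m)⁻¹ = (S ∪ S⁻¹) ^ m := by
    rw [← inv_pow, Set.union_inv, inv_inv, Set.union_comm]
  unfold wordLength
  congr 1
  ext n
  rw [Set.mem_ofPred_eq, Set.mem_ofPred_eq, ← Set.mem_inv, this]

/-- A function which is subadditive along `(S ∪ S⁻¹) ^ n` is dominated by the word length. -/
theorem le_mul_of_mem_pow {ℓ : H → ℝ} {M : ℝ} (hone : ℓ 1 ≤ 0)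
    (hmul : ∀ s ∈ S ∪ S⁻¹, ∀ g ∈ Subgroup.closure S, ℓ (s * g) ≤ ℓ s + ℓ g)
    (hM : ∀ s ∈ S ∪ S⁻¹, ℓ s ≤ M) (n : ℕ) :
    ∀ g ∈ (S ∪ S⁻¹) ^ n, ℓ g ≤ M * n ∧ g ∈ Subgroup.closure S := by
  have hS : S ∪ S⁻¹ ⊆ Subgroup.closure S := by
    rintro s (hs | hs)
    · exact Subgroup.subset_closure hs
    · exact (Subgroup.inv_mem_iff _).1 (Subgroup.subset_closure hs)
  -- Membership in the subgroup is carried along because subadditivity is assumed only there.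
  induction n with
  | zero =>
    intro g hg
    obtain rfl : g = 1 := by simpa using hg
    exact ⟨by simpa using hone, one_mem _⟩
  | succ n ih =>
    intro g hg
    rw [pow_succ', Set.mem_mul] at hg
    obtain ⟨s, hs, g, hg, rfl⟩ := hg
    obtain ⟨h1, h2⟩ := ih g hg
    refine ⟨?_, mul_mem (hS hs) h2⟩
    have := hmul s hs g h2
    have := hM s hs
    push_cast
    linarith

theorem le_mul_wordLength {ℓ : H → ℝ} {M : ℝ} (hone : ℓ 1 ≤ 0)
    (hmul : ∀ s ∈ S ∪ S⁻¹, ∀ g ∈ Subgroup.closure S, ℓ (s * g) ≤ ℓ s + ℓ g)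
    (hM : ∀ s ∈ S ∪ S⁻¹, ℓ s ≤ M) (hg : g ∈ Subgroup.closure S) :
    ℓ g ≤ M * wordLength S g :=
  (le_mul_of_mem_pow hone hmul hM _ g (mem_pow_wordLength hg)).1

/-- Word lengths are controlled by a homomorphism from a finitely generated group. -/
theorem exists_wordLength_map_le {H' : Type*} [Group H'] {T : Set H'} (f : H →* H')
    (hS : S.Finite) (hf : ∀ g ∈ Subgroup.closure S, f g ∈ Subgroup.closure T) :
    ∃ M : ℝ, 0 ≤ M ∧ ∀ g ∈ Subgroup.closure S,
      (wordLength T (f g) : ℝ) ≤ M * wordLength S g := by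
  have hS' : S ∪ S⁻¹ ⊆ Subgroup.closure S := by
    rintro s (hs | hs)
    · exact Subgroup.subset_closure hs
    · exact (Subgroup.inv_mem_iff _).1 (Subgroup.subset_closure hs)
  obtain ⟨M, hM⟩ := ((hS.union hS.inv).image fun s => (wordLength T (f s) : ℝ)).bddAbove
  refine ⟨max M 0, le_max_right _ _, fun g hg => ?_⟩
  refine le_mul_wordLength (ℓ := fun g => (wordLength T (f g) : ℝ)) ?_ ?_ ?_ hg
  · simp [wordLength_one]
  · intro s hs g hg
    rw [map_mul]
    exact_mod_cast wordLength_mul_le (hf _ (hS' hs)) (hf _ hg)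
  · intro s hs
    exact (hM (Set.mem_image_of_mem _ hs)).trans (le_max_left _ _)

theorem finite_setOf_wordLength_le (hS : S.Finite) (r : ℝ) :
    {g ∈ (Subgroup.closure S : Set H) | (wordLength S g : ℝ) ≤ r}.Finite := by
  have hfin : ∀ n : ℕ, ((S ∪ S⁻¹) ^ n).Finite := by
    intro n
    induction n with
    | zero => simp
    | succ n ih => rw [pow_succ]; exact ih.mul (hS.union hS.inv)
  refine ((Set.finite_Iic ⌊r⌋₊).biUnion fun n _ => hfin n).subset ?_
  rintro g ⟨hg, hgr⟩
  simp only [Set.mem_iUnion]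
  exact ⟨wordLength S g, Nat.le_floor hgr, mem_pow_wordLength hg⟩

end WordLength

section WordDist

variable {H : Type*} [Group H] {S : Set H}

theorem wordDist_self (g : H) : wordDist S g g = 0 := by
  simp [wordDist, wordLength_one]

theorem wordDist_nonneg (g h : H) : 0 ≤ wordDist S g h := Nat.cast_nonneg _

theorem wordDist_comm (g h : H) : wordDist S g h = wordDist S h g := by
  rw [wordDist, wordDist, ← wordLength_inv]
  simp

theorem wordDist_mul_left (k g h : H) : wordDist S (k * g) (k * h) = wordDist S g h := by
  simp [wordDist, mul_assoc]

theorem wordDist_triangle (hS : Subgroup.closure S = ⊤) (g h k : H) :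
    wordDist S g k ≤ wordDist S g h + wordDist S h k := by
  have : g⁻¹ * k = (g⁻¹ * h) * (h⁻¹ * k) := by group
  rw [wordDist, this, wordDist, wordDist, ← Nat.cast_add, Nat.cast_le]
  exact wordLength_mul_le (hS ▸ Subgroup.mem_top _) (hS ▸ Subgroup.mem_top _)

end WordDist

end ApproxGroup

namespace ApproxGroup

open Filter Topology

/-! ### The isometry group: topology, compact subsets and an adapted metric. -/

section IsometryGroup

variable {X : Type*} [MetricSpace X]

theorem tendsto_isometryGroup_iff_tendstoUniformlyOn {ι : Type*} {l : Filter ι}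
    {F : ι → X ≃ᵢ X} {g : X ≃ᵢ X} :
    Tendsto F l (𝓝 g) ↔ ∀ K : Set X, IsCompact K → TendstoUniformlyOn (fun i x => F i x) g l K := by
  rw [nhds_induced, tendsto_comap_iff,
    ContinuousMap.tendsto_iff_forall_isCompact_tendstoUniformlyOn]
  rfl

/-- The compact-open topology on the isometry group is the topology of pointwise convergence. -/
theorem tendsto_isometryGroup_iff {ι : Type*} {l : Filter ι} {F : ι → X ≃ᵢ X} {g : X ≃ᵢ X} :
    Tendsto F l (𝓝 g) ↔ ∀ x, Tendsto (fun i => F i x) l (𝓝 (g x)) := by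
  rw [tendsto_isometryGroup_iff_tendstoUniformlyOn]
  refine ⟨fun h x => (h {x} isCompact_singleton).tendsto_at rfl, fun h K hK => ?_⟩
  rw [Metric.tendstoUniformlyOn_iff]
  intro ε hε
  obtain ⟨t, -, htf, ht⟩ := hK.finite_cover_balls (show 0 < ε / 3 by positivity)
  have hev : ∀ᶠ i in l, ∀ y ∈ t, dist (F i y) (g y) < ε / 3 :=
    htf.eventually_all.2 fun y _ => (Metric.tendsto_nhds.1 (h y)) _ (by positivity)
  filter_upwards [hev] with i hi x hx
  obtain ⟨y, hy, hxy⟩ := Set.mem_iUnion₂.1 (ht hx)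
  have h1 : dist (g x) (g y) < ε / 3 := by rw [g.dist_eq]; exact hxy
  have h2 : dist (F i x) (F i y) < ε / 3 := by rw [(F i).dist_eq]; exact hxy
  have h3 := hi y hy
  have h4 := dist_triangle4 (g x) (g y) (F i y) (F i x)
  rw [dist_comm (g y), dist_comm (F i y) (F i x)] at h4
  linarith

theorem dist_inv_apply (g h : X ≃ᵢ X) (x : X) :
    dist (g⁻¹ x) (h⁻¹ x) = dist (g (h⁻¹ x)) x := by
  rw [← g.dist_eq, ← IsometryEquiv.mul_apply g g⁻¹, mul_inv_cancel, dist_comm]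
  rfl

theorem isTopologicalGroup_isometryGroup : IsTopologicalGroup (X ≃ᵢ X) where
  continuous_mul := by
    rw [continuous_iff_continuousAt]
    rintro ⟨g, h⟩
    refine tendsto_isometryGroup_iff.2 fun x => ?_
    have h1 : Tendsto (fun p : (X ≃ᵢ X) × (X ≃ᵢ X) => p.1 (h x)) (𝓝 (g, h)) (𝓝 (g (h x))) :=
      tendsto_isometryGroup_iff.1 continuous_fst.continuousAt (h x)
    have h2 : Tendsto (fun p : (X ≃ᵢ X) × (X ≃ᵢ X) => p.2 x) (𝓝 (g, h)) (𝓝 (h x)) :=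
      tendsto_isometryGroup_iff.1 continuous_snd.continuousAt x
    rw [tendsto_iff_dist_tendsto_zero] at h1 h2 ⊢
    refine squeeze_zero (fun _ => dist_nonneg) (fun p => ?_) (by simpa using h2.add h1)
    exact (dist_triangle _ (p.1 (h x)) _).trans
      (add_le_add (p.1.dist_eq (p.2 x) (h x)).le le_rfl)
  continuous_inv := by
    rw [continuous_iff_continuousAt]
    intro g
    refine tendsto_isometryGroup_iff.2 fun x => ?_
    have h1 : Tendsto (fun f : X ≃ᵢ X => f (g⁻¹ x)) (𝓝 g) (𝓝 (g (g⁻¹ x))) :=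
      tendsto_isometryGroup_iff.1 tendsto_id (g⁻¹ x)
    have hx : g (g⁻¹ x) = x := g.apply_symm_apply x
    rw [hx] at h1
    rw [tendsto_iff_dist_tendsto_zero] at h1 ⊢
    simpa only [dist_inv_apply] using h1

/-- Isometries displacing a point by a bounded amount form a compact set. -/
theorem isCompact_setOf_dist_le [ProperSpace X] (p q : X) (r : ℝ) :
    IsCompact {g : X ≃ᵢ X | dist (g p) q ≤ r} := by
  rw [isCompact_iff_ultrafilter_le_nhds']
  intro F hF
  have key (φ : (X ≃ᵢ X) → X) (R : ℝ) (hφ : ∀ g : X ≃ᵢ X, dist (g p) q ≤ r → dist (φ g) q ≤ R) :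
      ∃ y, Tendsto φ F (𝓝 y) := by
    have hmem : Metric.closedBall q R ∈ F.map φ := by
      rw [Ultrafilter.mem_map]
      exact mem_of_superset hF fun g hg => hφ g hg
    obtain ⟨y, -, hy⟩ := isCompact_iff_ultrafilter_le_nhds'.1 (isCompact_closedBall q R) _ hmem
    exact ⟨y, hy⟩
  have h1 (x : X) : ∃ y, Tendsto (fun g : X ≃ᵢ X => g x) F (𝓝 y) := by
    refine key _ (dist x p + r) fun g hg => ?_
    have := dist_triangle (g x) (g p) q
    rw [g.dist_eq] at this
    linarith
  -- A pointwise limit of isometries need not be onto, so the inverses are made to converge as well.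
  have h2 (x : X) : ∃ y, Tendsto (fun g : X ≃ᵢ X => g.symm x) F (𝓝 y) := by
    refine key _ (dist x q + r + dist p q) fun g hg => ?_
    have e : dist (g.symm x) p = dist x (g p) := by
      rw [← g.dist_eq, g.apply_symm_apply]
    have h3 := dist_triangle (g.symm x) p q
    have h4 := dist_triangle_right x (g p) q
    linarith
  choose f hf using h1
  choose f' hf' using h2
  -- The relation `d(gx, y) = d(x, g⁻¹y)` passes to the limit and makes `f` and `f'` mutually
  -- inverse.
  have hff (x y : X) : dist (f x) y = dist x (f' y) := by
    refine tendsto_nhds_unique ((hf x).dist tendsto_const_nhds)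
      (((tendsto_const_nhds (x := x)).dist (hf' y)).congr fun g => ?_)
    rw [← g.dist_eq, g.apply_symm_apply]
  have hl (x : X) : f' (f x) = x := by
    rw [eq_comm, ← dist_eq_zero, ← hff, dist_self]
  have hr (x : X) : f (f' x) = x := by
    rw [← dist_eq_zero, hff, dist_self]
  let g : X ≃ᵢ X := IsometryEquiv.mk' f f' hr (Isometry.of_dist_eq fun x y => by rw [hff, hl])
  refine ⟨g, ?_, tendsto_id'.1 (tendsto_isometryGroup_iff.2 hf)⟩
  exact le_of_tendsto ((hf p).dist tendsto_const_nhds) hF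

/-- The weighted uniform distance between two isometries. -/
noncomputable def weightedDist (p : X) (g h : X ≃ᵢ X) : ℝ :=
  ⨆ x, dist (g x) (h x) / (1 + dist x p) ^ 2

/-- `d(gx, hx)` grows at most linearly in `d(x, p)`, so the squared weight leaves one factor to
spare. Far points therefore contribute little, and uniform closeness on a large ball controls the
supremum. -/
theorem weighted_le (p : X) (g h : X ≃ᵢ X) (x : X) :
    dist (g x) (h x) / (1 + dist x p) ^ 2 ≤ (2 + dist (g p) (h p)) / (1 + dist x p) := by
  have h1 := dist_triangle4 (g x) (g p) (h p) (h x)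
  rw [g.dist_eq, h.dist_eq, dist_comm p x] at h1
  have h2 : 0 ≤ dist x p := dist_nonneg
  have h3 : 0 ≤ dist (g p) (h p) := dist_nonneg
  rw [div_le_div_iff₀ (by positivity) (by positivity)]
  nlinarith [mul_nonneg h2 h3, mul_nonneg h2 (mul_nonneg h2 h3), mul_nonneg h2 h2,
    mul_le_mul_of_nonneg_right h1 (show 0 ≤ 1 + dist x p by positivity)]

theorem bddAbove_weighted (p : X) (g h : X ≃ᵢ X) :
    BddAbove (Set.range fun x => dist (g x) (h x) / (1 + dist x p) ^ 2) := by
  refine ⟨2 + dist (g p) (h p), ?_⟩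
  rintro _ ⟨x, rfl⟩
  have h2 : 0 ≤ dist x p := dist_nonneg
  exact (weighted_le p g h x).trans (div_le_self (by positivity) (by linarith))

theorem dist_le_weightedDist (p : X) (g h : X ≃ᵢ X) (x : X) :
    dist (g x) (h x) ≤ (1 + dist x p) ^ 2 * weightedDist p g h := by
  rw [← div_le_iff₀' (by positivity)]
  exact le_ciSup (bddAbove_weighted p g h) x

/-- The metric on the isometry group defined by the weighted uniform distance. -/
noncomputable abbrev weightedMetricSpace (p : X) : MetricSpace (X ≃ᵢ X) where
  dist := weightedDist p
  dist_self g := by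
    have : Nonempty X := ⟨p⟩
    simp [weightedDist]
  dist_comm g h := by simp only [weightedDist, dist_comm]
  dist_triangle g h k := by
    have : Nonempty X := ⟨p⟩
    refine ciSup_le fun x => ?_
    refine le_trans ?_ (add_le_add (le_ciSup (bddAbove_weighted p g h) x)
      (le_ciSup (bddAbove_weighted p h k) x))
    rw [← add_div]
    gcongr
    exact dist_triangle _ _ _
  eq_of_dist_eq_zero {g h} hgh := by
    ext x
    refine dist_le_zero.1 ((dist_le_weightedDist p g h x).trans ?_)
    exact (mul_eq_zero_of_right _ hgh).le

theorem tendsto_dist_self {α : Type*} [PseudoMetricSpace α] (a : α) :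
    Tendsto (fun b => dist b a) (𝓝 a) (𝓝 0) :=
  tendsto_iff_dist_tendsto_zero.1 tendsto_id

theorem weightedMetricSpace_topology [ProperSpace X] (p : X) :
    (weightedMetricSpace p).toUniformSpace.toTopologicalSpace =
      (isometryGroupTopology : TopologicalSpace (X ≃ᵢ X)) := by
  have : Nonempty X := ⟨p⟩
  refine TopologicalSpace.ext_nhds fun g => le_antisymm ?_ ?_
  · refine tendsto_id'.1 (tendsto_isometryGroup_iff.2 fun x => ?_)
    have h0 := (@tendsto_dist_self _ (weightedMetricSpace p).toPseudoMetricSpace g).const_mul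
      ((1 + dist x p) ^ 2)
    rw [mul_zero] at h0
    rw [tendsto_iff_dist_tendsto_zero]
    exact squeeze_zero (fun _ => dist_nonneg) (fun h => dist_le_weightedDist p h g x) h0
  · rw [(@Metric.nhds_basis_closedBall _ (weightedMetricSpace p).toPseudoMetricSpace g).ge_iff]
    intro ε hε
    -- Once `d(hp, gp) ≤ 1`, points outside the ball of radius `R` contribute at most `(2 + 1) / R`.
    obtain ⟨R, hR0, hR⟩ : ∃ R : ℝ, 0 < R ∧ 3 / R ≤ ε :=
      ⟨3 / ε, by positivity, by rw [div_div_cancel₀ (by norm_num)]⟩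
    have hK := tendsto_isometryGroup_iff_tendstoUniformlyOn.1
      (tendsto_id (x := @nhds _ isometryGroupTopology g)) _ (isCompact_closedBall p R)
    have hev := (Metric.tendstoUniformlyOn_iff.1 hK) (min ε 1) (by positivity)
    filter_upwards [hev] with h hh
    change weightedDist p h g ≤ ε
    refine ciSup_le fun x => ?_
    have hx0 : 0 ≤ dist x p := dist_nonneg
    rcases le_or_gt (dist x p) R with hx | hx
    · have := hh x hx
      rw [dist_comm] at this
      refine (div_le_self dist_nonneg ?_).trans (this.le.trans (min_le_left _ _))
      exact one_le_pow₀ (by linarith)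
    · refine (weighted_le p h g x).trans (le_trans ?_ hR)
      have := hh p (Metric.mem_closedBall_self hR0.le)
      rw [dist_comm] at this
      have h1 : dist (h p) (g p) ≤ 1 := this.le.trans (min_le_right _ _)
      gcongr <;> linarith

theorem exists_isAdaptedMetric_isometryGroup [ProperSpace X] (p : X) :
    ∃ m : MetricSpace (X ≃ᵢ X), IsAdaptedMetric m := by
  let m := (weightedMetricSpace p).replaceTopology (weightedMetricSpace_topology p).symm
  refine ⟨m, rfl, ⟨fun g r => ?_⟩, fun k g h => ?_⟩
  · refine IsCompact.of_isClosed_subset (isCompact_setOf_dist_le p (g p) r)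
      Metric.isClosed_closedBall fun h hh => ?_
    have := dist_le_weightedDist p h g p
    rw [dist_self, add_zero, one_pow, one_mul] at this
    exact this.trans hh
  · change weightedDist p (k * g) (k * h) = weightedDist p g h
    simp only [weightedDist, IsometryEquiv.mul_apply, k.dist_eq]

end IsometryGroup

end ApproxGroup

namespace ApproxGroup

open Filter Topology

/-! ### Milnor–Schwarz for cobounded actions on geodesic spaces. -/

section CoboundedActions

variable {G Y : Type*} [Group G] [MetricSpace Y] {act : G →* (Y ≃ᵢ Y)} {p : Y} {R : ℝ}

theorem dist_act_mul_le (act : G →* (Y ≃ᵢ Y)) (p : Y) (g h : G) :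
    dist (act (g * h) p) p ≤ dist (act g p) p + dist (act h p) p := by
  have h1 := dist_triangle (act (g * h) p) (act g p) p
  rw [map_mul, IsometryEquiv.mul_apply, (act g).dist_eq] at h1
  rw [map_mul, IsometryEquiv.mul_apply]
  linarith

theorem dist_act_inv_mul (act : G →* (Y ≃ᵢ Y)) (p : Y) (g h : G) :
    dist (act (g⁻¹ * h) p) p = dist (act g p) (act h p) := by
  rw [← (act g).dist_eq, ← IsometryEquiv.mul_apply, ← map_mul, mul_inv_cancel_left, dist_comm]

theorem dist_act_inv (act : G →* (Y ≃ᵢ Y)) (p : Y) (g : G) :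
    dist (act g⁻¹ p) p = dist (act g p) p := by
  have := dist_act_inv_mul act p g 1
  simpa using this

/-- If the action is cobounded on a geodesic space, then every element is a product of elements
of small displacement, whose number is linear in the displacement. -/
theorem exists_mem_pow_of_isGeodesicSpace (hY : IsGeodesicSpace Y)
    (hR : ∀ y, ∃ g, dist (act g p) y ≤ R) (g : G) :
    ∃ n : ℕ, (n : ℝ) ≤ dist (act g p) p + 2 ∧
      g ∈ {g : G | dist (act g p) p ≤ 2 * R + 1} ^ n := by
  have hR0 : 0 ≤ R := by
    obtain ⟨h, hh⟩ := hR p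
    exact dist_nonneg.trans hh
  obtain ⟨c, hc0, hc1, hc⟩ := hY p (act g p)
  set L := dist p (act g p) with hL
  have hL0 : 0 ≤ L := dist_nonneg
  set n := ⌊L⌋₊ + 1 with hn
  have hn0 : (0 : ℝ) < n := by rw [hn]; positivity
  have hLn : L / n ≤ 1 := by
    rw [div_le_one hn0, hn]
    push_cast
    exact (Nat.lt_floor_add_one L).le
  have hmem (i : ℕ) (hi : i ≤ n) : (i : ℝ) * (L / n) ∈ Set.Icc 0 L := by
    refine ⟨by positivity, ?_⟩
    have : (i : ℝ) ≤ n := by exact_mod_cast hi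
    calc (i : ℝ) * (L / n) ≤ n * (L / n) := by gcongr
      _ = L := by field_simp
  -- The geodesic is cut into `n` pieces of length at most 1. Orbit points within `R` of consecutive
  -- cut points differ by an element of displacement at most `2R + 1`. The exponent is `i + 1`
  -- because the element chosen near the starting point is itself a factor.
  have key (i : ℕ) (hi : i ≤ n) : ∀ h, dist (act h p) (c (i * (L / n))) ≤ R →
      h ∈ {g : G | dist (act g p) p ≤ 2 * R + 1} ^ (i + 1) := by
    induction i with
    | zero =>
      intro h hh
      rw [Nat.cast_zero, zero_mul, hc0] at hh
      rw [zero_add, pow_one]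
      exact hh.trans (by linarith)
    | succ i ih =>
      intro h hh
      obtain ⟨k, hk⟩ := hR (c (i * (L / n)))
      rw [pow_succ, ← mul_inv_cancel_left k h]
      refine Set.mul_mem_mul (ih (by omega) k hk) ?_
      change dist (act (k⁻¹ * h) p) p ≤ 2 * R + 1
      rw [dist_act_inv_mul]
      have h1 := hc _ (hmem i (by omega)) _ (hmem (i + 1) hi)
      have h2 : |(i : ℝ) * (L / n) - ((i + 1 : ℕ) : ℝ) * (L / n)| = L / n := by
        push_cast
        rw [← sub_mul, abs_mul, abs_of_nonneg (show 0 ≤ L / n by positivity)]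
        simp
      rw [h2] at h1
      have h3 := dist_triangle4 (act k p) (c (i * (L / n))) (c ((i + 1 : ℕ) * (L / n))) (act h p)
      rw [dist_comm (c ((i + 1 : ℕ) * (L / n)))] at h3
      linarith
  refine ⟨n + 1, ?_, key n le_rfl g ?_⟩
  · have := Nat.floor_le hL0
    rw [dist_comm, ← hL, hn]
    push_cast
    linarith
  · rw [mul_div_cancel₀ _ hn0.ne', hc1, dist_self]
    exact hR0

theorem closure_setOf_dist_le (hY : IsGeodesicSpace Y) (hR : ∀ y, ∃ g, dist (act g p) y ≤ R) :
    Subgroup.closure {g : G | dist (act g p) p ≤ 2 * R + 1} = ⊤ := by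
  refine (Subgroup.eq_top_iff' _).2 fun g => ?_
  obtain ⟨n, -, hn⟩ := exists_mem_pow_of_isGeodesicSpace hY hR g
  -- With `ℓ = 0` only the membership half of the lemma is used.
  exact (le_mul_of_mem_pow (ℓ := fun _ => 0) (M := 0) le_rfl (by simp) (by simp) n g
    (Set.pow_subset_pow_left Set.subset_union_left hn)).2

end CoboundedActions

section CompactGeneration

variable {G : Type*} [Group G] [TopologicalSpace G]

/-- Compact sets are bounded for the word length of a compact generating set. -/
theorem exists_wordLength_le_of_isCompact [IsTopologicalGroup G] [T2Space G] [BaireSpace G]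
    {Q P : Set G} (hQ : IsCompact Q) (hQG : Subgroup.closure Q = ⊤) (hP : IsCompact P) :
    ∃ N : ℕ, ∀ g ∈ P, wordLength Q g ≤ N := by
  have htop (g : G) : g ∈ Subgroup.closure Q := hQG ▸ Subgroup.mem_top g
  have hcpt (n : ℕ) : IsCompact ((Q ∪ Q⁻¹) ^ n) := by
    induction n with
    | zero => simp
    | succ n ih => rw [pow_succ]; exact ih.mul (hQ.union hQ.inv)
  -- By Baire some power of `Q ∪ Q⁻¹` has interior. Translates of that interior are open sets of
  -- bounded word length, and finitely many of them cover `P`.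
  obtain ⟨n, g₀, hg₀⟩ := nonempty_interior_of_iUnion_of_closed (fun n => (hcpt n).isClosed)
    (Set.eq_univ_of_forall fun g =>
      Set.mem_iUnion.2 (exists_mem_pow_of_mem_closure (htop g)))
  refine hP.induction_on (p := fun s => ∃ N : ℕ, ∀ g ∈ s, wordLength Q g ≤ N) ⟨0, by simp⟩
    (fun s t hst ⟨N, hN⟩ => ⟨N, fun g hg => hN g (hst hg)⟩)
    (fun s t ⟨N, hN⟩ ⟨N', hN'⟩ => ⟨max N N', ?_⟩) (fun g _ => ?_)
  · rintro g (hg | hg)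
    · exact (hN g hg).trans (le_max_left _ _)
    · exact (hN' g hg).trans (le_max_right _ _)
  · refine ⟨(fun h => g₀ * g⁻¹ * h) ⁻¹' interior ((Q ∪ Q⁻¹) ^ n), mem_nhdsWithin_of_mem_nhds ?_,
      wordLength Q (g * g₀⁻¹) + n, fun h hh => ?_⟩
    · refine (isOpen_interior.preimage (by fun_prop)).mem_nhds ?_
      simpa using hg₀
    · have h1 : h = (g * g₀⁻¹) * (g₀ * g⁻¹ * h) := by group
      have h2 : wordLength Q (g₀ * g⁻¹ * h) ≤ n := wordLength_le_of_mem_pow (interior_subset hh)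
      have h3 := wordLength_mul_le (htop (g * g₀⁻¹)) (htop (g₀ * g⁻¹ * h))
      rw [← h1] at h3
      omega

/-- The word metric of a compact generating set is quasi-isometric to the orbit metric of a
cobounded action on a geodesic space with compact sets of bounded displacement. -/
theorem exists_wordDist_dist_act_le [IsTopologicalGroup G] [T2Space G] [BaireSpace G]
    {Y : Type*} [MetricSpace Y] {act : G →* (Y ≃ᵢ Y)} {p : Y} {R : ℝ} (hY : IsGeodesicSpace Y)
    (hR : ∀ y, ∃ g, dist (act g p) y ≤ R)
    (hcpt : ∀ r, IsCompact {g : G | dist (act g p) p ≤ r})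
    (hbdd : ∀ Q : Set G, IsCompact Q → ∃ M, ∀ g ∈ Q, dist (act g p) p ≤ M)
    {Q : Set G} (hQ : IsCompact Q) (hQG : Subgroup.closure Q = ⊤) :
    ∃ M : ℝ, 0 ≤ M ∧ ∀ g h : G, dist (act g p) (act h p) ≤ M * wordDist Q g h ∧
      wordDist Q g h ≤ M * dist (act g p) (act h p) + M := by
  have htop (g : G) : g ∈ Subgroup.closure Q := hQG ▸ Subgroup.mem_top g
  obtain ⟨M, hM⟩ := hbdd _ hQ
  obtain ⟨N, hN⟩ := exists_wordLength_le_of_isCompact hQ hQG (hcpt (2 * R + 1))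
  have hupper (g : G) : dist (act g p) p ≤ M * wordLength Q g := by
    refine le_mul_wordLength (ℓ := fun g => dist (act g p) p) (by simp)
      (fun g _ h _ => dist_act_mul_le act p g h) ?_ (htop g)
    rintro s (hs | hs)
    · exact hM s hs
    · rw [← inv_inv s, dist_act_inv]
      exact hM _ hs
  have hlower (g : G) : (wordLength Q g : ℝ) ≤ N * (dist (act g p) p + 2) := by
    obtain ⟨n, hn, hgn⟩ := exists_mem_pow_of_isGeodesicSpace hY hR g
    -- Each factor of small displacement lies in a compact set, so it costs at most `N` letters of
    -- `Q`.
    refine le_trans (le_mul_of_mem_pow (S := {g : G | dist (act g p) p ≤ 2 * R + 1})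
      (ℓ := fun g => (wordLength Q g : ℝ)) (M := N) (by simp [wordLength_one])
      (fun g _ h _ => by exact_mod_cast wordLength_mul_le (htop g) (htop h)) ?_ n g
      (Set.pow_subset_pow_left Set.subset_union_left hgn)).1 (by gcongr)
    rintro s (hs | hs)
    · exact_mod_cast hN s hs
    · rw [← inv_inv s, wordLength_inv]
      exact_mod_cast hN _ hs
  refine ⟨max |M| (2 * N), by positivity, fun g h => ⟨?_, ?_⟩⟩
  · rw [← dist_act_inv_mul]
    refine (hupper _).trans ?_
    exact mul_le_mul_of_nonneg_right ((le_abs_self M).trans (le_max_left _ _)) (Nat.cast_nonneg _)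
  · have h1 := hlower (g⁻¹ * h)
    rw [dist_act_inv_mul] at h1
    have h2 : (2 * N : ℝ) ≤ max |M| (2 * N) := le_max_right _ _
    have h3 : 0 ≤ dist (act g p) (act h p) := dist_nonneg
    have h4 : (0 : ℝ) ≤ N := Nat.cast_nonneg _
    have h5 := mul_le_mul_of_nonneg_right h2 h3
    rw [wordDist]
    nlinarith [mul_nonneg h4 h3]

end CompactGeneration

/-! ### Isometries of Kleiner–Leeb spaces at bounded distance from the identity. -/

section KleinerLeebSpaces

variable {X : Type*} [MetricSpace X]

/-- An isometry of a Kleiner–Leeb space at bounded distance from the identity is the identity. -/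
theorem IsKleinerLeebSpace.eq_one_of_dist_le (hX : IsKleinerLeebSpace X) {h : X ≃ᵢ X} {M : ℝ}
    (hM : ∀ x, dist (h x) x ≤ M) : h = 1 := by
  classical
  rcases isEmpty_or_nonempty X with hE | ⟨⟨p⟩⟩
  · exact IsometryEquiv.ext fun x => hE.elim x
  have hM0 : 0 ≤ M := dist_nonneg.trans (hM p)
  -- Uniqueness applies only within `D`, which might be smaller than `M`. In the unbounded case,
  -- collapsing a large ball to `p` is a quasi-isometry whose constants force `D > M`.
  by_cases hfar : ∃ q, 2 * M + 1 ≤ dist q p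
  · obtain ⟨q, hq⟩ := hfar
    set r := dist q p with hr
    let f : X → X := fun x => if dist x p ≤ r then p else x
    have hf (x : X) : dist (f x) x ≤ r := by
      by_cases hx : dist x p ≤ r
      · simp only [f, hx, if_true]
        rwa [dist_comm]
      · simp only [f, hx, if_false, dist_self]
        linarith
    obtain ⟨D, hD, hrig⟩ := hX.rigid 1 (2 * r + 1) le_rfl (by linarith)
    obtain ⟨g, hg, -⟩ := hrig f ⟨fun x y => by
        have := dist_triangle4 x (f x) (f y) y
        rw [dist_comm x (f x)] at this
        have := hf x
        have := hf y
        linarith, fun x y => by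
        have := dist_triangle4_right (f x) (f y) x y
        have := hf x
        have := hf y
        linarith, r + 1, by linarith, fun y => ⟨y, by linarith [hf y]⟩⟩
    have h1 := hg p
    have h2 := hg q
    have hfp : f p = p := by simp [f]
    have hfq : f q = p := by simp [f, ← hr]
    rw [hfp] at h1
    rw [hfq] at h2
    -- Both `p` and `q` collapse to `p`, so `r = d(gp, gq) < 2D`, while `r ≥ 2M + 1`. The same `D`
    -- then serves for the identity map, which is within `D` of both `h` and `1`.
    have h3 := dist_triangle_left (g q) (g p) p
    rw [g.dist_eq] at h3
    refine (hrig id ⟨fun x y => ?_, fun x y => ?_, 1, one_pos, fun y => ⟨y, by simp⟩⟩).unique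
      (fun x => ?_) (fun x => ?_)
    · simp only [id]; linarith
    · simp only [id]; linarith
    · have := hM x
      rw [dist_comm] at this
      simp only [id]
      linarith
    · simpa using hD
  · push Not at hfar
    -- Now `X` has diameter at most `4M + 2` and the constant map is a quasi-isometry. As `g` is
    -- onto, all of `X` is within `D` of `p`, so every isometry is close to the constant map and
    -- uniqueness makes them all equal.
    obtain ⟨D, hD, hrig⟩ := hX.rigid 1 (4 * M + 2) le_rfl (by linarith)
    have hu := hrig (fun _ => p) ⟨fun x y => by
        have := dist_triangle_right x y p
        have := hfar x
        have := hfar y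
        rw [dist_self]
        linarith, fun x y => by
        have : 0 ≤ dist x y := dist_nonneg
        rw [dist_self]
        linarith, 2 * M + 1, by linarith, fun y => ⟨p, by rw [dist_comm]; exact hfar y⟩⟩
    obtain ⟨g, hg⟩ := hu.exists
    have hall (k : X ≃ᵢ X) (x : X) : dist p (k x) < D := by
      have := hg (g.symm (k x))
      rwa [g.apply_symm_apply] at this
    exact hu.unique (hall h) (hall 1)

theorem IsKleinerLeebSpace.exists_dist_le (hX : IsKleinerLeebSpace X) (p : X) :
    ∃ R : ℝ, ∀ y, ∃ g : X ≃ᵢ X, dist (g p) y ≤ R := by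
  obtain ⟨Q, hQ, hQX⟩ := hX.cocompact
  obtain ⟨R, hR⟩ := hQ.isBounded.subset_closedBall p
  refine ⟨R, fun y => ?_⟩
  obtain ⟨g, q, hq, rfl⟩ := hQX y
  refine ⟨g, ?_⟩
  rw [g.dist_eq, dist_comm]
  exact hR hq

end KleinerLeebSpaces

end ApproxGroup

namespace ApproxGroup

open Filter Topology

/-! ### Left translations almost preserve `Λ`. -/

section AlmostInvariance

variable {Γ : Type*} [Group Γ] {S Λ : Set Γ}

/-- Left translation by `g` maps `Λ` into the `c`-neighbourhood of `Λ`. -/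
def AlmostPreserves (S Λ : Set Γ) (c : ℝ) (g : Γ) : Prop :=
  ∀ a : Λ, ∃ b : Λ, wordDist S (g * a) b ≤ c

theorem AlmostPreserves.mul (hS : Subgroup.closure S = ⊤) {c c' : ℝ} {g g' : Γ}
    (h : AlmostPreserves S Λ c g) (h' : AlmostPreserves S Λ c' g') :
    AlmostPreserves S Λ (c + c') (g * g') := by
  intro a
  obtain ⟨b, hb⟩ := h' a
  obtain ⟨b', hb'⟩ := h b
  refine ⟨b', (wordDist_triangle hS _ (g * b) _).trans ?_⟩
  rw [mul_assoc, wordDist_mul_left, add_comm]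
  exact add_le_add hb' hb

/-- The covering `Λ² ⊆ FΛ` is applied to `(ga)⁻¹ = sb`, so that `b⁻¹ = (ga)s`. Inversion moves `s ∈
F` to the right, where it costs only its length in a left-invariant metric. The bound is uniform
over `Λ`. -/
theorem exists_almostPreserves_of_mem {K : ℝ} (hΛ : IsApproximateSubgroup K Λ) (S : Set Γ) :
    ∃ c : ℝ, ∀ g ∈ Λ, AlmostPreserves S Λ c g := by
  obtain ⟨F, -, hF⟩ := hΛ.sq_covBySMul
  have hinv {a : Γ} (ha : a ∈ Λ) : a⁻¹ ∈ Λ := by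
    rw [← hΛ.inv_eq_self]
    simpa using ha
  obtain ⟨c, hc⟩ := (F.finite_toSet.image fun g => (wordLength S g : ℝ)).bddAbove
  refine ⟨c, fun g hg a => ?_⟩
  have hga : (a : Γ)⁻¹ * g⁻¹ ∈ Λ ^ 2 := by
    rw [sq]
    exact Set.mul_mem_mul (hinv a.2) (hinv hg)
  obtain ⟨s, hs, b, hb, hsb⟩ := Set.mem_smul.1 (hF hga)
  refine ⟨⟨b⁻¹, hinv hb⟩, ?_⟩
  have h1 : (g * a)⁻¹ * b⁻¹ = s := by
    rw [mul_inv_rev, ← hsb, smul_eq_mul, mul_inv_cancel_right]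
  rw [wordDist, h1]
  exact hc (Set.mem_image_of_mem _ hs)

theorem exists_almostPreserves (hΛ : IsApproximateGroup Λ) (hS : Subgroup.closure S = ⊤) (g : Γ) :
    ∃ c : ℝ, AlmostPreserves S Λ c g := by
  obtain ⟨K, hK⟩ := hΛ.exists_isApproximateSubgroup
  obtain ⟨c, hc⟩ := exists_almostPreserves_of_mem hK S
  have hg : g ∈ Subgroup.closure Λ := hΛ.closure_eq_top ▸ Subgroup.mem_top g
  obtain ⟨n, hn⟩ := exists_mem_pow_of_mem_closure hg
  have hΛΛ : Λ ∪ Λ⁻¹ = Λ := by rw [hK.inv_eq_self, Set.union_self]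
  rw [hΛΛ] at hn
  induction n generalizing g with
  | zero =>
    obtain rfl : g = 1 := by simpa using hn
    exact ⟨0, fun a => ⟨a, by rw [one_mul, wordDist_self]⟩⟩
  | succ n ih =>
    rw [pow_succ'] at hn
    obtain ⟨s, hs, g, hgn, rfl⟩ := Set.mem_mul.1 hn
    obtain ⟨c', hc'⟩ := ih g (hΛ.closure_eq_top ▸ Subgroup.mem_top g) hgn
    exact ⟨c + c', (hc s hs).mul hS hc'⟩

end AlmostInvariance

/-! ### From translations of `Λ` to isometries. -/

section Tracking

variable {Γ G Y : Type*} [Group Γ] [Group G] [MetricSpace Y] {S Λ : Set Γ} {A B R : ℝ}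
  {φ : Λ → Y} {act : G →* (Y ≃ᵢ Y)}

/-- The isometry `act k` is at bounded distance from left translation by `g`, transported to `Y`
by the quasi-isometry `φ`. -/
def Tracks (S : Set Γ) (φ : Λ → Y) (act : G →* (Y ≃ᵢ Y)) (A M : ℝ) (g : Γ) (k : G) : Prop :=
  ∀ a b : Λ, dist (act k (φ a)) (φ b) ≤ A * wordDist S (g * a) b + M

/-- `φ` is a quasi-isometry, with the constants that are convenient for composition. -/
structure IsCoarseEquivalence (S : Set Γ) (φ : Λ → Y) (A B R : ℝ) : Prop where
  one_le : 1 ≤ A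
  nonneg : 0 ≤ B
  upper : ∀ a b : Λ, dist (φ a) (φ b) ≤ A * wordDist S (a : Γ) b + B
  lower : ∀ a b : Λ, wordDist S (a : Γ) b ≤ A * dist (φ a) (φ b) + B
  dense : ∀ y, ∃ a, dist (φ a) y ≤ R

/-- The two errors may differ: `k⁻¹k'` moves every point a bounded amount, and no bound is required
in advance. Multiplicativity of `ρ` needs this freedom, since errors grow under composition. -/
theorem Tracks.unique (hS : Subgroup.closure S = ⊤) (hΛ : IsApproximateGroup Λ)
    (hφ : IsCoarseEquivalence S φ A B R)
    (hfix : ∀ (k : G) (M : ℝ), (∀ y, dist (act k y) y ≤ M) → k = 1) {M M' : ℝ} {g : Γ} {k k' : G}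
    (h : Tracks S φ act A M g k) (h' : Tracks S φ act A M' g k') : k = k' := by
  obtain ⟨c, hc⟩ := exists_almostPreserves hΛ hS g
  have hA := hφ.one_le
  refine (inv_mul_eq_one.1 (hfix (k⁻¹ * k') (2 * R + (A * c + M) + (A * c + M')) fun y => ?_))
  obtain ⟨a, ha⟩ := hφ.dense y
  obtain ⟨b, hb⟩ := hc a
  rw [dist_act_inv_mul]
  have h1 := h a b
  have h2 := h' a b
  have h3 : A * wordDist S (g * a) b ≤ A * c := by gcongr
  have h4 := dist_triangle4 (act k y) (act k (φ a)) (act k' (φ a)) (act k' y)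
  have h5 := dist_triangle_right (act k (φ a)) (act k' (φ a)) (φ b)
  rw [(act k).dist_eq, (act k').dist_eq, dist_comm y] at h4
  linarith

theorem Tracks.mul (hS : Subgroup.closure S = ⊤) (hΛ : IsApproximateGroup Λ)
    (hA : 0 ≤ A) {M M' : ℝ} {g g' : Γ} {k k' : G}
    (h : Tracks S φ act A M g k) (h' : Tracks S φ act A M' g' k') :
    ∃ M'', Tracks S φ act A M'' (g * g') (k * k') := by
  obtain ⟨c, hc⟩ := exists_almostPreserves hΛ hS g'
  refine ⟨A * c + M' + A * c + M, fun a b => ?_⟩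
  obtain ⟨x, hx⟩ := hc a
  have h1 := h' a x
  have h2 := h x b
  have h3 := wordDist_triangle hS (g * x) (g * (g' * a)) b
  rw [wordDist_mul_left, wordDist_comm (x : Γ), ← mul_assoc] at h3
  have h4 := dist_triangle (act (k * k') (φ a)) (act k (φ x)) (φ b)
  rw [map_mul, IsometryEquiv.mul_apply, (act k).dist_eq] at h4
  have h5 : A * wordDist S (g' * a) x ≤ A * c := by gcongr
  have h6 := mul_le_mul_of_nonneg_left h3 hA
  rw [map_mul, IsometryEquiv.mul_apply]
  linarith

/-- `M` depends on `c` but not on `g`; this uniformity is what later keeps `ρ a` close to `φ a` for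
all `a ∈ Λ`. -/
theorem exists_tracks (hS : Subgroup.closure S = ⊤) (hΛ : IsApproximateGroup Λ)
    (hφ : IsCoarseEquivalence S φ A B R)
    (hrig : ∀ K C : ℝ, 1 ≤ K → 0 < C → ∃ D : ℝ, ∀ f : Y → Y,
      IsQuasiIsometryWith dist dist K C f → ∃ k : G, ∀ y, dist (f y) (act k y) < D) (c : ℝ) :
    ∃ M, ∀ g, AlmostPreserves S Λ c g → ∃ k, Tracks S φ act A M g k := by
  have hA := hφ.one_le
  have hB := hφ.nonneg
  choose ψ hψ using hφ.dense
  -- The part up to `+ B` is the error of the upper bound for `φ ∘ L ∘ ψ`, the bracketed rest that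
  -- of the lower bound.
  set E := A * (A * (2 * R) + B + 2 * c) + B + (2 * R + B + A * (2 * c + B)) with hE
  obtain ⟨D, hD⟩ := hrig (A ^ 2) (max E 1) (one_le_pow₀ hA) (by positivity)
  refine ⟨A * (c + A * R + B) + B + D, fun g hg => ?_⟩
  choose L hL using hg
  have hL2 (a b : Λ) : wordDist S (L a : Γ) (L b) ≤ wordDist S (a : Γ) b + 2 * c ∧
      wordDist S (a : Γ) b ≤ wordDist S (L a : Γ) (L b) + 2 * c := by
    have h1 := wordDist_triangle hS (L a : Γ) (g * a) (L b)
    have h2 := wordDist_triangle hS (g * a) (g * b) (L b)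
    have h3 := wordDist_triangle hS (g * a) (L a) (g * b)
    have h4 := wordDist_triangle hS (L a : Γ) (L b) (g * b)
    rw [wordDist_comm (L a : Γ) (g * a)] at h1
    rw [wordDist_comm (L b : Γ) (g * b)] at h4
    rw [wordDist_mul_left] at h2 h3
    have := hL a
    have := hL b
    constructor <;> linarith
  let f : Y → Y := fun y => φ (L (ψ y))
  have hψ1 (y z : Y) : dist (φ (ψ y)) (φ (ψ z)) ≤ dist y z + 2 * R := by
    have := dist_triangle4 (φ (ψ y)) y z (φ (ψ z))
    rw [dist_comm z] at this
    linarith [hψ y, hψ z]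
  have hψ2 (y z : Y) : dist y z ≤ dist (φ (ψ y)) (φ (ψ z)) + 2 * R := by
    have := dist_triangle4 y (φ (ψ y)) (φ (ψ z)) z
    rw [dist_comm y (φ (ψ y))] at this
    linarith [hψ y, hψ z]
  have hR0 : Nonempty Y → 0 ≤ R := fun ⟨y⟩ => dist_nonneg.trans (hψ y)
  have hc0 : Nonempty Y → 0 ≤ c := fun ⟨y⟩ => (wordDist_nonneg _ _).trans (hL (ψ y))
  have hmul {x y : ℝ} (hxy : x ≤ y) : A * x ≤ A * y := mul_le_mul_of_nonneg_left hxy (by linarith)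
  have hEmax : E ≤ max E 1 := le_max_left _ _
  have hf : IsQuasiIsometryWith dist dist (A ^ 2) (max E 1) f := by
    refine ⟨fun y z => ?_, fun y z => ?_, ?_⟩
    · have := hR0 ⟨y⟩
      have := hc0 ⟨y⟩
      have h1 := hψ2 y z
      have h2 := (hφ.upper (ψ y) (ψ z)).trans (add_le_add_left (hmul ((hL2 _ _).2.trans
        (add_le_add_left (hφ.lower (L (ψ y)) (L (ψ z))) _))) _)
      have h3 : 0 ≤ A * (A * (2 * R) + B + 2 * c) + B := by positivity
      rw [one_div, inv_mul_le_iff₀ (by positivity)]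
      simp only [f]
      nlinarith
    · have := hR0 ⟨y⟩
      have := hc0 ⟨y⟩
      have h1 := hφ.upper (L (ψ y)) (L (ψ z))
      have h2 := hmul ((hL2 (ψ y) (ψ z)).1.trans (add_le_add_left ((hφ.lower (ψ y) (ψ z)).trans
        (add_le_add_left (hmul (hψ1 y z)) _)) _))
      have h3 : 0 ≤ 2 * R + B + A * (2 * c + B) := by positivity
      simp only [f]
      nlinarith
    -- Here `c'` depends on `g`, which is harmless: the density radius does not enter the constants
    -- that determine `D`.
    · obtain ⟨c', hc'⟩ := exists_almostPreserves hΛ hS g⁻¹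
      refine ⟨|A * (c + (A * R + B) + c') + B + R| + 1, by positivity, fun y => ?_⟩
      obtain ⟨b, hb⟩ := hc' (ψ y)
      refine ⟨φ b, lt_of_le_of_lt ?_ (lt_add_one _)⟩
      refine le_trans ?_ (le_abs_self _)
      have h1 := hφ.upper (L (ψ (φ b))) (ψ y)
      have h2 := wordDist_triangle hS (L (ψ (φ b)) : Γ) (g * ψ (φ b)) (ψ y)
      have h3 := wordDist_triangle hS (g * ψ (φ b)) (g * b) (ψ y)
      have h4 : wordDist S (g * b) (ψ y) = wordDist S (g⁻¹ * ψ y) b := by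
        rw [← wordDist_mul_left g (g⁻¹ * _), mul_inv_cancel_left, wordDist_comm]
      rw [wordDist_comm (L (ψ (φ b)) : Γ) (g * ψ (φ b))] at h2
      rw [wordDist_mul_left] at h3
      have h5 := hφ.lower (ψ (φ b)) b
      have h6 := hmul (hψ (φ b))
      have h7 := hL (ψ (φ b))
      have h8 := hmul (show wordDist S (L (ψ (φ b)) : Γ) (ψ y) ≤ c + (A * R + B) + c' by linarith)
      have h9 := dist_triangle (φ (L (ψ (φ b)))) (φ (ψ y)) y
      have h10 := hψ y
      simp only [f]
      linarith
  obtain ⟨k, hk⟩ := hD f hf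
  refine ⟨k, fun a b => ?_⟩
  have h1 := hk (φ a)
  have h2 := dist_triangle_left (act k (φ a)) (φ b) (f (φ a))
  have h3 := hφ.upper (L (ψ (φ a))) b
  have h4 := wordDist_triangle hS (L (ψ (φ a)) : Γ) (g * ψ (φ a)) b
  have h5 := wordDist_triangle hS (g * ψ (φ a)) (g * a) b
  rw [wordDist_comm (L (ψ (φ a)) : Γ) (g * ψ (φ a))] at h4
  rw [wordDist_mul_left] at h5
  have h6 := hL (ψ (φ a))
  have h7 := hφ.lower (ψ (φ a)) a
  have h8 := hmul (hψ (φ a))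
  have h9 := hmul (show wordDist S (L (ψ (φ a)) : Γ) b ≤
    (c + A * R + B) + wordDist S (g * a) b by linarith)
  simp only [f] at h2
  linarith

/-- A rigid action turns the left translations of `Λ` into a homomorphism. -/
theorem exists_hom_dist_le (hS : Subgroup.closure S = ⊤) (hΛ : IsApproximateGroup Λ)
    (hφ : IsCoarseEquivalence S φ A B R)
    (hrig : ∀ K C : ℝ, 1 ≤ K → 0 < C → ∃ D : ℝ, ∀ f : Y → Y,
      IsQuasiIsometryWith dist dist K C f → ∃ k : G, ∀ y, dist (f y) (act k y) < D)
    (hfix : ∀ (k : G) (M : ℝ), (∀ y, dist (act k y) y ≤ M) → k = 1) (p : Y) :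
    ∃ ρ : Γ →* G, ∃ M : ℝ, ∀ a : Λ, dist (act (ρ a) p) (φ a) ≤ M := by
  have hA := hφ.one_le
  obtain ⟨K, hK⟩ := hΛ.exists_isApproximateSubgroup
  have hex (g : Γ) : ∃ k M, Tracks S φ act A M g k := by
    obtain ⟨c, hc⟩ := exists_almostPreserves hΛ hS g
    obtain ⟨M, hM⟩ := exists_tracks hS hΛ hφ hrig c
    obtain ⟨k, hk⟩ := hM g hc
    exact ⟨k, M, hk⟩
  choose ρ μ hρ using hex
  obtain ⟨c, hc⟩ := exists_almostPreserves_of_mem hK S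
  obtain ⟨M, hM⟩ := exists_tracks hS hΛ hφ hrig c
  let e : Λ := ⟨1, hK.one_mem⟩
  refine ⟨MonoidHom.mk' ρ fun g g' => ?_, dist p (φ e) + M, fun a => ?_⟩
  · obtain ⟨M'', h⟩ := (hρ g).mul hS hΛ (by linarith) (hρ g')
    exact (hρ (g * g')).unique hS hΛ hφ hfix h
  · obtain ⟨k, hk⟩ := hM a (hc a a.2)
    have hk' : ρ a = k := (hρ a).unique hS hΛ hφ hfix hk
    -- Translation by `a` sends the identity to `a`, so tracking at `e` compares `k (φ e)` directly
    -- with `φ a`.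
    have h1 := hk e a
    rw [mul_one, wordDist_self, mul_zero, zero_add] at h1
    have h2 := dist_triangle (act k p) (act k (φ e)) (φ a)
    rw [(act k).dist_eq] at h2
    rw [MonoidHom.mk'_apply, hk']
    linarith

end Tracking

end ApproxGroup

namespace ApproxGroup

open Filter Topology

/-! ### Small kernel and the Delone property. -/

section GeometricRepresentation

variable {Γ G Y : Type*} [Group Γ] [Group G] [MetricSpace Y] {S Λ : Set Γ} {A B R M : ℝ}
  {φ : Λ → Y} {act : G →* (Y ≃ᵢ Y)} {ρ : Γ →* G} {p : Y}

theorem IsCoarseEquivalence.wordDist_le (hφ : IsCoarseEquivalence S φ A B R)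
    (hρ : ∀ a : Λ, dist (act (ρ a) p) (φ a) ≤ M) (a b : Λ) :
    wordDist S (a : Γ) b ≤ A * (dist (act (ρ a) p) (act (ρ b) p) + 2 * M) + B := by
  have h1 := dist_triangle4_left (act (ρ a) p) (act (ρ b) p) (φ a) (φ b)
  have h2 := mul_le_mul_of_nonneg_left (h1.trans (add_le_add_right
    (add_le_add (hρ a) (hρ b)) _)) (zero_le_one.trans hφ.one_le)
  linarith [hφ.lower a b]

theorem map_mem_closure_image (hΛ : Subgroup.closure Λ = ⊤) (ρ : Γ →* G) (g : Γ) :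
    ρ g ∈ Subgroup.closure (ρ '' Λ) := by
  rw [← MonoidHom.map_closure, hΛ]
  exact Subgroup.mem_map_of_mem ρ (Subgroup.mem_top g)

/-- The upper bound holds for any homomorphism from a finitely generated group. For the lower bound,
`ρ a` and `ρ b` close in word metric displace `p` to nearby points, hence `a` and `b` are close. -/
theorem hasSmallKernel_of_dist_le (hS : S.Finite) (hSΓ : Subgroup.closure S = ⊤)
    (hΛ : IsApproximateGroup Λ) (hφ : IsCoarseEquivalence S φ A B R)
    (hρ : ∀ a : Λ, dist (act (ρ a) p) (φ a) ≤ M) : HasSmallKernel Λ ρ := by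
  intro S' hS' hS'Γ T hT hTρ
  have htop' (g : Γ) : g ∈ Subgroup.closure S' := hS'Γ ▸ Subgroup.mem_top g
  have hmem (g : Γ) : ρ g ∈ Subgroup.closure T :=
    hTρ ▸ map_mem_closure_image hΛ.closure_eq_top ρ g
  obtain ⟨N, hN, hSS'⟩ := exists_wordLength_map_le (T := S') (MonoidHom.id Γ) hS
    fun g _ => htop' g
  obtain ⟨N', hN', hTS'⟩ := exists_wordLength_map_le (T := T) ρ hS' fun g _ => hmem g
  obtain ⟨L, hL⟩ := ((hT.union hT.inv).image fun g => dist (act g p) p).bddAbove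
  have hdisp (g : G) (hg : g ∈ Subgroup.closure T) :
      dist (act g p) p ≤ max L 0 * wordLength T g :=
    le_mul_wordLength (ℓ := fun g => dist (act g p) p) (by simp)
      (fun g _ h _ => dist_act_mul_le act p g h)
      (fun s hs => (hL (Set.mem_image_of_mem _ hs)).trans (le_max_left _ _)) hg
  have hL0 : 0 ≤ max L 0 := le_max_right _ _
  have hA := hφ.one_le
  have hB := hφ.nonneg
  have hM : 0 ≤ M := by
    obtain ⟨K, hK⟩ := hΛ.exists_isApproximateSubgroup
    exact dist_nonneg.trans (hρ ⟨1, hK.one_mem⟩)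
  refine ⟨N * A * max L 0 + N' + 1, N * (A * (2 * M) + B), ?_, by positivity,
    fun a b => ?_, fun a b => ?_, 1, one_pos, ?_⟩
  · have : 0 ≤ N * A * max L 0 + N' := by positivity
    linarith
  · have h1 : wordDist S' (a : Γ) b ≤ N * wordDist S (a : Γ) b :=
      hSS' _ (hSΓ ▸ Subgroup.mem_top _)
    have h2 := mul_le_mul_of_nonneg_left (hφ.wordDist_le hρ a b) hN
    have h3 := hdisp ((ρ a)⁻¹ * ρ b) (mul_mem (inv_mem (hmem a)) (hmem b))
    rw [dist_act_inv_mul] at h3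
    change dist (act (ρ a) p) (act (ρ b) p) ≤ _ * wordDist T (ρ a) (ρ b) at h3
    have h4 := mul_le_mul_of_nonneg_left h3 (show 0 ≤ N * A by positivity)
    have h5 : 0 ≤ (N' + 1) * wordDist T (ρ a) (ρ b) :=
      mul_nonneg (by positivity) (wordDist_nonneg _ _)
    rw [one_div, inv_mul_le_iff₀ (by positivity)]
    change _ ≤ _ * wordDist T (ρ a) (ρ b)
    linarith
  · have h1 : wordDist T (ρ a) (ρ b) ≤ N' * wordDist S' (a : Γ) b := by
      have := hTS' ((a : Γ)⁻¹ * b) (htop' _)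
      rwa [map_mul, map_inv] at this
    have h2 : 0 ≤ (N * A * max L 0 + 1) * wordDist S' (a : Γ) b :=
      mul_nonneg (by positivity) (wordDist_nonneg _ _)
    have h3 : 0 ≤ N * (A * (2 * M) + B) := by positivity
    change wordDist T (ρ a) (ρ b) ≤ _
    linarith
  · rintro ⟨_, a, ha, rfl⟩
    refine ⟨⟨a, ha⟩, ?_⟩
    change wordDist T (ρ a) (ρ a) < 1
    rw [wordDist_self]
    exact one_pos

theorem isDelone_image_of_dist_le [TopologicalSpace G] {m : MetricSpace G} (hm : IsAdaptedMetric m)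
    (hcpt : ∀ r, IsCompact {g : G | dist (act g p) p ≤ r})
    (hcont : Continuous fun g : G => dist (act g p) p)
    (hdense : ∀ g : G, ∃ a : Λ, dist (act (ρ a) p) (act g p) ≤ R)
    (hfin : ∀ r, {g : Γ | ∃ a b : Λ, dist (act (ρ a) p) (act (ρ b) p) ≤ r ∧
      (a : Γ)⁻¹ * b = g}.Finite) :
    IsDelone (ρ '' Λ) := by
  obtain ⟨rfl, hproper, hinv⟩ := hm
  have hdist (g h : G) : dist g h = dist 1 (g⁻¹ * h) := by
    rw [← hinv g⁻¹, inv_mul_cancel]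
  obtain ⟨ε, hε, hball⟩ : ∃ ε : ℝ, 0 < ε ∧ ∀ g : G, dist g 1 ≤ ε → dist (act g p) p ≤ 1 := by
    have : {g : G | dist (act g p) p < 1} ∈ 𝓝 (1 : G) :=
      (isOpen_lt hcont continuous_const).mem_nhds (by simp)
    obtain ⟨ε, hε, hball⟩ := Metric.nhds_basis_closedBall.mem_iff.1 this
    exact ⟨ε, hε, fun g hg => (hball hg).le⟩
  -- When the orbit points are within 1, `(ρ a)⁻¹ ρ b` lies in a finite set, and some ball around
  -- `1` avoids its nontrivial elements.
  obtain ⟨δ, hδ, hsep⟩ : ∃ δ : ℝ, 0 < δ ∧ ∀ a b : Λ,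
      dist (act (ρ a) p) (act (ρ b) p) ≤ 1 → ρ a ≠ ρ b → δ ≤ dist (ρ a) (ρ b) := by
    have hF := ((hfin 1).image ρ).subset (Set.sdiff_subset (t := {1}))
    obtain ⟨δ, hδ, hsep⟩ := Metric.mem_nhds_iff.1
      (hF.isClosed.isOpen_compl.mem_nhds (show (1 : G) ∈ _ by simp))
    refine ⟨δ, hδ, fun a b hab hne => ?_⟩
    by_contra! hlt
    rw [hdist, dist_comm] at hlt
    refine hsep hlt ⟨⟨_, ⟨a, b, hab, rfl⟩, by simp⟩, ?_⟩
    simpa [inv_mul_eq_one] using hne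
  obtain ⟨C, hC⟩ := (hcpt R).isBounded.subset_closedBall (1 : G)
  set r := min ε δ / 2 with hr
  have hr0 : 0 < r := by positivity
  refine ⟨_, ⟨rfl, hproper, hinv⟩, ⟨ρ '' Λ, ⟨r, hr0.le⟩, hr0, ?_, ⟨max C 1, by positivity⟩, ?_, ?_⟩, rfl⟩
  · rintro _ ⟨a, ha, rfl⟩ _ ⟨b, hb, rfl⟩ hne
    have key : r < dist (ρ a) (ρ b) := by
      by_contra! hle
      have hεδ : 0 < min ε δ := by positivity
      have h1 : dist (act (ρ a) p) (act (ρ b) p) ≤ 1 := by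
        rw [← dist_act_inv_mul]
        refine hball _ ?_
        rw [dist_comm, ← hdist]
        have := min_le_left ε δ
        linarith
      have h2 := hsep ⟨a, ha⟩ ⟨b, hb⟩ h1 hne
      have := min_le_right ε δ
      linarith
    change ENNReal.ofNNReal ⟨r, hr0.le⟩ < edist (ρ a) (ρ b)
    rw [edist_nndist]
    exact ENNReal.coe_lt_coe.2 (NNReal.coe_lt_coe.1 key)
  · exact lt_of_lt_of_le one_pos (le_max_right C 1)
  · intro g _
    obtain ⟨a, ha⟩ := hdense g
    refine ⟨ρ a, ⟨a, a.2, rfl⟩, ?_⟩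
    change edist g (ρ a) ≤ ENNReal.ofNNReal ⟨max C 1, _⟩
    rw [edist_nndist]
    -- Relative density: `(ρ a)⁻¹ g` has displacement at most `R`, so it lies in a fixed compact
    -- set.
    have h1 : (ρ a)⁻¹ * g ∈ Metric.closedBall (1 : G) C := by
      refine hC ?_
      change dist (act ((ρ a)⁻¹ * g) p) p ≤ R
      rwa [dist_act_inv_mul]
    have h2 : dist g (ρ a) ≤ max C 1 := by
      rw [dist_comm, hdist, dist_comm]
      exact (Metric.mem_closedBall.1 h1).trans (le_max_left _ _)
    exact ENNReal.coe_le_coe.2 (NNReal.coe_le_coe.1 h2)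

/-- An abstract action on `Y` is allowed so that the case of empty `X`, which offers no base point,
is covered by a one-point `Y`. -/
theorem exists_isGeometricRepresentation [TopologicalSpace G] [IsTopologicalGroup G] [T2Space G]
    [BaireSpace G] (hm : ∃ m : MetricSpace G, IsAdaptedMetric m) (hY : IsGeodesicSpace Y)
    (hR : ∀ y, ∃ g, dist (act g p) y ≤ R)
    (hcpt : ∀ r, IsCompact {g : G | dist (act g p) p ≤ r})
    (hcont : Continuous fun g : G => dist (act g p) p)
    (hrig : ∀ K C : ℝ, 1 ≤ K → 0 < C → ∃ D : ℝ, ∀ f : Y → Y,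
      IsQuasiIsometryWith dist dist K C f → ∃ k : G, ∀ y, dist (f y) (act k y) < D)
    (hfix : ∀ (k : G) (M : ℝ), (∀ y, dist (act k y) y ≤ M) → k = 1)
    (hΛ : IsApproximateGroup Λ) (hΛG : QuasiIsometricToGroup Λ G) :
    ∃ ρ : Γ →* G, IsGeometricRepresentation Λ ρ := by
  obtain ⟨S, hS, hSΓ, Q, hQ, hQG, f, K, C, hK, hC, hf⟩ := hΛG
  obtain ⟨N, hN, hNQ⟩ := exists_wordDist_dist_act_le hY hR hcpt
    (fun Q hQ => (hQ.image hcont).bddAbove.imp fun M hM g hg => hM (Set.mem_image_of_mem _ hg))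
    hQ hQG
  obtain ⟨R', -, hR'⟩ := hf.coarselyOnto
  have hφ : IsCoarseEquivalence S (fun a : Λ => act (f a) p) (N * K + 1) (N * C + K * N + C)
      (N * R' + R) := by
    refine ⟨?_, by positivity, fun a b => ?_, fun a b => ?_, fun y => ?_⟩
    · have : 0 ≤ N * K := by positivity
      linarith
    · have h1 := (hNQ (f a) (f b)).1
      have h2 := mul_le_mul_of_nonneg_left (hf.upper a b) hN
      have h3 : 0 ≤ K * N := by positivity
      have h4 := wordDist_nonneg (S := S) (a : Γ) b
      linarith
    · have h1 := (hNQ (f a) (f b)).2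
      have h2 := hf.lower a b
      rw [one_div, inv_mul_le_iff₀ (by positivity)] at h2
      have h3 := mul_le_mul_of_nonneg_left h1 (zero_le_one.trans hK)
      have h4 : 0 ≤ N * C := by positivity
      have h5 : 0 ≤ dist (act (f a) p) (act (f b) p) := dist_nonneg
      linarith
    · obtain ⟨g, hg⟩ := hR y
      obtain ⟨a, ha⟩ := hR' g
      refine ⟨a, (dist_triangle _ (act g p) _).trans (add_le_add ?_ hg)⟩
      exact (hNQ _ _).1.trans (mul_le_mul_of_nonneg_left ha.le hN)
  obtain ⟨ρ, M, hρ⟩ := exists_hom_dist_le hSΓ hΛ hφ hrig hfix p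
  obtain ⟨k, hk⟩ := hΛ.exists_isApproximateSubgroup
  obtain ⟨m, hm⟩ := hm
  refine ⟨ρ, hasSmallKernel_of_dist_le hS hSΓ hΛ hφ hρ, ⟨k, hk.image ρ⟩,
    isDelone_image_of_dist_le (R := M + (N * R' + R)) hm hcpt hcont (fun g => ?_) fun r => ?_⟩
  · obtain ⟨a, ha⟩ := hφ.dense (act g p)
    exact ⟨a, (dist_triangle _ (act (f a) p) _).trans (add_le_add (hρ a) ha)⟩
  · refine (finite_setOf_wordLength_le hS
      ((N * K + 1) * (r + 2 * M) + (N * C + K * N + C))).subset ?_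
    rintro _ ⟨a, b, hab, rfl⟩
    refine ⟨hSΓ ▸ Subgroup.mem_top _, (hφ.wordDist_le hρ a b).trans ?_⟩
    gcongr

end GeometricRepresentation

/-! ### Conclusion for Kleiner–Leeb spaces, with the empty space treated separately. -/

section Rigidity

variable {X : Type*} [MetricSpace X]

theorem IsKleinerLeebSpace.isCompactlyGeneratedLCSCGroup_of_nonempty (hX : IsKleinerLeebSpace X)
    (p : X) : IsCompactlyGeneratedLCSCGroup (X ≃ᵢ X) := by
  have := hX.proper
  obtain ⟨R, hR⟩ := hX.exists_dist_le p
  have hgen := closure_setOf_dist_le (act := MonoidHom.id (X ≃ᵢ X)) hX.geodesic hR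
  have htop := isTopologicalGroup_isometryGroup (X := X)
  obtain ⟨m, hm, hproper, -⟩ := exists_isAdaptedMetric_isometryGroup p
  have hcpt := isCompact_setOf_dist_le p p (2 * R + 1)
  refine ⟨htop, ?_, ?_, ?_, _, hcpt, hgen⟩
  all_goals
    rw [← hm]
    infer_instance

/-- The isometry group of an empty metric space is a compactly generated lcsc group. -/
theorem isCompactlyGeneratedLCSCGroup_of_isEmpty [IsEmpty X] :
    IsCompactlyGeneratedLCSCGroup (X ≃ᵢ X) :=
  have : Subsingleton (X ≃ᵢ X) := ⟨fun _ _ => IsometryEquiv.ext fun x => isEmptyElim x⟩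
  ⟨isTopologicalGroup_isometryGroup, inferInstance, inferInstance, inferInstance, Set.univ,
    isCompact_univ, Subgroup.closure_univ⟩

theorem isAdaptedMetric_of_subsingleton {G : Type*} [Group G] [TopologicalSpace G]
    [Subsingleton G] : ∃ m : MetricSpace G, IsAdaptedMetric m := by
  let m : MetricSpace G :=
    { dist := fun _ _ => 0
      dist_self := fun _ => rfl
      dist_comm := fun _ _ => rfl
      dist_triangle := fun _ _ _ => by simp
      eq_of_dist_eq_zero := fun _ => Subsingleton.elim _ _ }
  exact ⟨m, Subsingleton.elim _ _, inferInstance, fun _ _ _ => rfl⟩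

theorem isQIRigid_of_isEmpty [IsEmpty X] : IsQIRigid.{_, v} (X ≃ᵢ X) := by
  intro Γ _ Λ hΛ _ hΛG
  have hsub : Subsingleton (X ≃ᵢ X) := ⟨fun _ _ => IsometryEquiv.ext fun x => isEmptyElim x⟩
  have := isTopologicalGroup_isometryGroup (X := X)
  refine exists_isGeometricRepresentation (Y := PUnit.{1}) (act := 1) (p := PUnit.unit) (R := 0)
    isAdaptedMetric_of_subsingleton (fun x y => ⟨fun _ => x, rfl, rfl, fun s hs t ht => ?_⟩)
    (fun _ => ⟨1, by simp⟩) (fun r => (Set.toFinite _).isCompact) (by fun_prop)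
    (fun K C _ _ => ⟨1, fun f _ => ⟨1, fun y => by simp⟩⟩) (fun k _ _ => Subsingleton.elim _ _)
    hΛ hΛG
  have h : dist x y = 0 := by simp
  rw [h, Set.Icc_self, Set.mem_singleton_iff] at hs ht
  simp [hs, ht]

theorem IsKleinerLeebSpace.isQIRigid_of_nonempty (hX : IsKleinerLeebSpace X) (p : X) :
    IsQIRigid.{_, v} (X ≃ᵢ X) := by
  intro Γ _ Λ hΛ _ hΛG
  have := hX.proper
  obtain ⟨R, hR⟩ := hX.exists_dist_le p
  obtain ⟨htop, ht2, hlc, -, -⟩ := hX.isCompactlyGeneratedLCSCGroup_of_nonempty p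
  refine exists_isGeometricRepresentation (act := MonoidHom.id (X ≃ᵢ X)) (p := p) (R := R)
    (exists_isAdaptedMetric_isometryGroup p) hX.geodesic hR (isCompact_setOf_dist_le p p) ?_
    (fun K C hK hC => ?_) (fun k M hM => hX.eq_one_of_dist_le hM) hΛ hΛG
  · refine Continuous.dist ?_ continuous_const
    exact continuous_iff_continuousAt.2 fun g => tendsto_isometryGroup_iff.1 tendsto_id p
  · obtain ⟨D, -, hD⟩ := hX.rigid K C hK hC
    exact ⟨D, fun f hf => (hD f hf).exists⟩

end Rigidity

end ApproxGroup

theorem mainTheorem4 (X : Type u) [MetricSpace X]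
    (hX : ApproxGroup.IsKleinerLeebSpace X) :
    ApproxGroup.IsCompactlyGeneratedLCSCGroup (X ≃ᵢ X) ∧
      ApproxGroup.IsQIRigid.{u, v} (X ≃ᵢ X) := by
  rcases isEmpty_or_nonempty X with hE | ⟨⟨p⟩⟩
  · exact ⟨ApproxGroup.isCompactlyGeneratedLCSCGroup_of_isEmpty, ApproxGroup.isQIRigid_of_isEmpty⟩
  · exact ⟨hX.isCompactlyGeneratedLCSCGroup_of_nonempty p, hX.isQIRigid_of_nonempty p⟩
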